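/- Let $\boldsymbol{T} = \mathbb{R} \cup \{-\infty\}$ be the tropical semifield, with $a \oplus b = \max\{a,b\}$ and $a \odot b = a + b$. Let $\overline{\boldsymbol{T}(\boldsymbol{X})}_n$ be the tropical rational function semifield in $n$ variables: the semifield of fractions of the semiring of tropical Laurent polynomials in $n$ variables over $\boldsymbol{T}$, where two tropical Laurent polynomials are identified if they take the same value at every point of $\mathbb{R}^n$. For a congruence $E$ on $\overline{\boldsymbol{T}(\boldsymbol{X})}_n$ put $\boldsymbol{V}(E) = \{x \in \mathbb{R}^n \mid f(x) = g(x) \text{ for all } (f,g) \in E\}$, and for $V \subseteq \mathbb{R}^n$ let $\boldsymbol{E}(V)$ be the congruence of all pairs $(f,g)$ with $f(x) = g(x)$ for all $x \in V$. Let $S$ be a $\boldsymbol{T}$-algebra (a commutative semiring with a semiring homomorphism from $\boldsymbol{T}$; real numbers are regarded as elements of $S$ through it), let $\psi : \overline{\boldsymbol{T}(\boldsymbol{X})}_n \to S$ be a surjective $\boldsymbol{T}$-algebra homomorphism, and let $\operatorname{Ker}(\psi) = \{(f,g) \mid \psi(f) = \psi(g)\}$. Write $\oplus$ and $\odot$ for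 the addition and multiplication of $S$; every nonzero element $s$ of $S$ has a multiplicative inverse $s^{\odot(-1)}$. Suppose that $\operatorname{Ker}(\psi)$ is finitely generated as a congruence and that $\operatorname{Ker}(\psi) = \boldsymbol{E}(\boldsymbol{V}(\operatorname{Ker}(\psi)))$. Then the following are equivalent: (1) $\boldsymbol{V}(\operatorname{Ker}(\psi))$ is nonempty and disconnected (in the Euclidean topology of $\mathbb{R}^n$); (2) there exist $s \in S \setminus \{0_S\}$ and $a_1, a_2, a_3 \in \mathbb{R}$ with $a_3 < a_2 < a_1$ and $a_1 - a_2 = a_2 - a_3$ such that $$s \neq s \oplus a_3, \qquad s \neq \left(s^{\odot(-1)} \oplus a_1^{\odot(-1)}\right)^{\odot(-1)},$$ $$(s \oplus a_1) \odot \left(s^{\odot(-1)} \oplus a_2^{\odot(-1)}\right)^{\odot(-1)} = \left(a_1 \odot a_2^{\odot(-1)}\right) \odot (s \oplus a_2) \odot \left(s^{\odot(-1)} \oplus a_3^{\odot(-1)}\right)^{\odot(-1)}.$$ -/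

import Mathlib

open scoped Ring

namespace TropicalVariety

/-- The tropical semifield `𝕋 = ℝ ∪ {-∞}` with `a ⊕ b = max a b` and `a ⊙ b = a + b`.
`Tropical` adds by `min` in the type it wraps; as the order of `ℝ` is reversed here, this is the
maximum of real numbers, and the added top element, the zero of the semiring, is `-∞`. -/
abbrev MaxTrop : Type := Tropical (WithTop ℝᵒᵈ)

/-- A real number as an element of the tropical semifield. -/
def real (a : ℝ) : MaxTrop := Tropical.trop ((OrderDual.toDual a : ℝᵒᵈ) : WithTop ℝᵒᵈ)

theorem real_add_real (a b : ℝ) : real a + real b = real (max a b) := rfl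

theorem real_mul_real (a b : ℝ) : real a * real b = real (a + b) := rfl

theorem one_eq_real : (1 : MaxTrop) = real 0 := rfl

theorem real_ne_zero (a : ℝ) : real a ≠ 0 :=
  fun h => WithTop.coe_ne_top (Tropical.trop_injective h)

theorem real_injective : Function.Injective real := fun _ _ h =>
  OrderDual.toDual.injective (WithTop.coe_injective (Tropical.trop_injective h))

theorem exists_real {t : MaxTrop} (ht : t ≠ 0) : ∃ a : ℝ, t = real a := by
  induction t using Tropical.tropRec with
  | h t =>
    induction t using WithTop.recTopCoe with
    | top => exact absurd rfl ht
    | coe a => exact ⟨OrderDual.ofDual a, rfl⟩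

theorem isUnit_of_ne_zero {t : MaxTrop} (ht : t ≠ 0) : IsUnit t := by
  obtain ⟨a, rfl⟩ := exists_real ht
  exact IsUnit.of_mul_eq_one (real (-a)) (by rw [real_mul_real, add_neg_cancel, one_eq_real])

theorem sum_eq_zero {ι : Type*} (s : Finset ι) (f : ι → MaxTrop) :
    ∑ i ∈ s, f i = 0 ↔ ∀ i ∈ s, f i = 0 := by
  classical
  induction s using Finset.induction_on with
  | empty => simp
  | insert a s ha ih => simp [Finset.sum_insert ha, ih]

/-- The tropical Laurent polynomial semiring `𝕋[X₁^±, …, Xₙ^±]`. -/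
abbrev LaurentPoly (n : ℕ) : Type := AddMonoidAlgebra MaxTrop (Fin n → ℤ)

/-- The value `i₁ x₁ + ⋯ + iₙ xₙ` at `x ∈ ℝⁿ` of the monomial with exponent vector `i ∈ ℤⁿ`. -/
noncomputable def monomialEval {n : ℕ} (x : Fin n → ℝ) :
    Multiplicative (Fin n → ℤ) →* MaxTrop where
  toFun i := real (∑ j, (i.toAdd j : ℝ) * x j)
  map_one' := by simp [one_eq_real]
  map_mul' i k := by
    simp [real_mul_real, add_mul, Finset.sum_add_distrib]

/-- Evaluation of tropical Laurent polynomials at a point of `ℝⁿ`. -/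
noncomputable def evalLaurent {n : ℕ} (x : Fin n → ℝ) : LaurentPoly n →ₐ[MaxTrop] MaxTrop :=
  AddMonoidAlgebra.lift MaxTrop MaxTrop (Fin n → ℤ) (monomialEval x)

theorem evalLaurent_eq_zero {n : ℕ} {x : Fin n → ℝ} {F : LaurentPoly n}
    (h : evalLaurent x F = 0) : F = 0 := by
  rw [evalLaurent, AddMonoidAlgebra.lift_apply', Finsupp.sum, sum_eq_zero] at h
  ext i
  by_contra hi
  exact (mul_ne_zero hi (real_ne_zero _)) (h i (Finsupp.mem_support_iff.mpr hi))

/-- The congruence on tropical Laurent polynomials of having the same values on all of `ℝⁿ`. -/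
def sameValues (n : ℕ) : RingCon (LaurentPoly n) where
  r F G := ∀ x : Fin n → ℝ, evalLaurent x F = evalLaurent x G
  iseqv := ⟨fun _ _ => rfl, fun h x => (h x).symm, fun h k x => (h x).trans (k x)⟩
  add' h k x := by rw [map_add, map_add, h x, k x]
  mul' h k x := by rw [map_mul, map_mul, h x, k x]

/-- The semiring of tropical Laurent polynomial functions: tropical Laurent polynomials up to
equality of their values. -/
abbrev LaurentFun (n : ℕ) : Type := (sameValues n).Quotient

/-- Evaluation of tropical Laurent polynomial functions at a point of `ℝⁿ`. -/
noncomputable def evalLaurentFun {n : ℕ} (x : Fin n → ℝ) : LaurentFun n →+* MaxTrop :=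
  (sameValues n).lift (evalLaurent x : LaurentPoly n →+* MaxTrop) (fun _ _ h => h x)

theorem evalLaurentFun_ext {n : ℕ} {F G : LaurentFun n}
    (h : ∀ x, evalLaurentFun x F = evalLaurentFun x G) : F = G := by
  induction F using Quotient.inductionOn' with
  | h F =>
    induction G using Quotient.inductionOn' with
    | h G => exact Quotient.sound' h

theorem evalLaurentFun_eq_zero {n : ℕ} {x : Fin n → ℝ} {F : LaurentFun n}
    (h : evalLaurentFun x F = 0) : F = 0 := by
  induction F using Quotient.inductionOn' with
  | h F =>
    have hF : F = 0 := evalLaurent_eq_zero h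
    subst hF
    rfl

instance (n : ℕ) : Nontrivial (LaurentFun n) :=
  (evalLaurentFun (0 : Fin n → ℝ)).domain_nontrivial

instance (n : ℕ) : NoZeroDivisors (LaurentFun n) where
  eq_zero_or_eq_zero_of_mul_eq_zero {F G} h := by
    have h0 : evalLaurentFun 0 F * evalLaurentFun 0 G = 0 := by rw [← map_mul, h, map_zero]
    exact (mul_eq_zero.mp h0).imp evalLaurentFun_eq_zero evalLaurentFun_eq_zero

/-- The tropical rational function semifield in `n` variables: the fractions of tropical Laurent
polynomial functions. The denominators are exactly the functions other than `-∞`, as the non-zero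
divisors of a nontrivial semiring without zero divisors are its nonzero elements. -/
abbrev RatFun (n : ℕ) : Type := Localization (nonZeroDivisors (LaurentFun n))

theorem isUnit_evalLaurentFun {n : ℕ} (x : Fin n → ℝ) (F : nonZeroDivisors (LaurentFun n)) :
    IsUnit (evalLaurentFun x (F : LaurentFun n)) :=
  isUnit_of_ne_zero fun h => nonZeroDivisors.ne_zero F.2 (evalLaurentFun_eq_zero h)

/-- The value `f(x) ∈ 𝕋` of a tropical rational function `f` at a point `x ∈ ℝⁿ`. -/
noncomputable def eval {n : ℕ} (x : Fin n → ℝ) : RatFun n →+* MaxTrop :=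
  IsLocalization.lift (M := nonZeroDivisors (LaurentFun n)) (S := RatFun n)
    (isUnit_evalLaurentFun x)

/-- Every tropical rational function other than `-∞` is invertible. -/
theorem RatFun.isUnit_of_ne_zero {n : ℕ} {f : RatFun n} (hf : f ≠ 0) : IsUnit f := by
  obtain ⟨⟨F, G⟩, rfl⟩ := IsLocalization.mk'_surjective (nonZeroDivisors (LaurentFun n)) f
  have hF : F ≠ 0 := by
    rintro rfl
    exact hf (IsLocalization.mk'_zero G)
  exact IsUnit.of_mul_eq_one
    (IsLocalization.mk' (RatFun n) (G : LaurentFun n) ⟨F, mem_nonZeroDivisors_of_ne_zero hF⟩)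
    (IsLocalization.mk'_mul_mk'_eq_one' F G (mem_nonZeroDivisors_of_ne_zero hF))

/-- The congruence `E(V)` of the pairs of tropical rational functions that agree on `V ⊆ ℝⁿ`. -/
def congruenceOf {n : ℕ} (V : Set (Fin n → ℝ)) : RingCon (RatFun n) where
  r f g := ∀ x ∈ V, eval x f = eval x g
  iseqv := ⟨fun _ _ _ => rfl, fun h x hx => (h x hx).symm,
    fun h k x hx => (h x hx).trans (k x hx)⟩
  add' h k x hx := by rw [map_add, map_add, h x hx, k x hx]
  mul' h k x hx := by rw [map_mul, map_mul, h x hx, k x hx]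

/-- The congruence variety `V(E) ⊆ ℝⁿ` of a congruence `E` on tropical rational functions. -/
def congruenceVariety {n : ℕ} (E : RingCon (RatFun n)) : Set (Fin n → ℝ) :=
  {x | ∀ f g : RatFun n, E f g → eval x f = eval x g}

/-- A congruence is finitely generated if it is the smallest congruence that contains some finite
set of pairs. -/
def CongruenceFG {R : Type*} [Semiring R] (E : RingCon R) : Prop :=
  ∃ t : Finset (R × R), E = ringConGen fun a b => (a, b) ∈ t

/-- The kernel congruence `Ker(ψ)` of the pairs `(f, g)` with `ψ f = ψ g`. -/
noncomputable abbrev kerCongruence {n : ℕ} {S : Type*} [CommSemiring S] [Algebra MaxTrop S]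
    (ψ : RatFun n →ₐ[MaxTrop] S) : RingCon (RatFun n) :=
  RingCon.ker (ψ : RatFun n →+* S)

/-- If `S` is the image of a tropical rational function semifield, then every nonzero element of
`S` is invertible; so `Ring.inverse` is the genuine inverse on the nonzero elements of `S`. -/
theorem isUnit_of_surjective {n : ℕ} {S : Type*} [CommSemiring S] [Algebra MaxTrop S]
    {ψ : RatFun n →ₐ[MaxTrop] S} (hψ : Function.Surjective ψ) {s : S} (hs : s ≠ 0) :
    IsUnit s := by
  obtain ⟨f, rfl⟩ := hψ s
  exact (RatFun.isUnit_of_ne_zero fun hf => hs (by rw [hf, map_zero])).map ψ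

/-- The image in a `𝕋`-algebra of a real number, regarded as an element of `𝕋`. -/
noncomputable def cst (S : Type*) [CommSemiring S] [Algebra MaxTrop S] (a : ℝ) : S :=
  algebraMap MaxTrop S (real a)

end TropicalVariety

/-! Write `V` for the variety of the kernel. As the kernel is `E(V)`, equations in `S` are equations
between functions on `V`, and a nonzero `s` is the image of a rational function with a continuous
real-valued `φ`. By `separation_conditions_iff`, the three conditions say that on `V` the function
`φ` goes below `a₃`, goes above `a₁`, and avoids the open interval between them. The intermediate
value theorem then excludes connectedness.

Conversely, a finitely generated kernel makes `V` a union of finitely many closed polyhedra whose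
inequalities have integral slopes (`exists_cell_subset_congruenceVariety`). They are convex, so a
disconnection of `V` sorts them into two families with disjoint members. Disjoint polyhedra, unlike
arbitrary disjoint closed convex sets, have a uniform gap: by Fourier–Motzkin elimination an
infeasible finite affine system is violated by a fixed `ε > 0` (`exists_pos_le_affineVal`). The
minimum over one family of the maximum of the defining inequalities is a rational function, at most
`0` on that family and at least some `ε > 0` on the other (`exists_represents_separating`). -/

namespace TropicalVariety

/-! ### Infeasible systems of affine inequalities -/

/-- Finitely many lower bounds and finitely many upper bounds that are compatible in pairs have a
common solution. -/
theorem exists_between_of_finite {L U : Set ℝ} (hL : L.Finite) (hU : U.Finite)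
    (h : ∀ l ∈ L, ∀ u ∈ U, l ≤ u) : ∃ t, (∀ l ∈ L, l ≤ t) ∧ ∀ u ∈ U, t ≤ u := by
  rcases L.eq_empty_or_nonempty with rfl | hne
  · obtain ⟨t, ht⟩ := hU.bddBelow
    exact ⟨t, by simp, fun u hu => ht hu⟩
  · obtain ⟨l, hl, hmax⟩ := hL.exists_maximalFor id L hne
    refine ⟨l, fun k hk => ?_, h l hl⟩
    rcases le_total k l with hkl | hkl
    · exact hkl
    · exact hmax hk hkl

/-- The value at `x` of the affine function with linear part `p.1` and constant term `p.2`. -/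
def affineVal {n : ℕ} (p : (Fin n → ℝ) × ℝ) (x : Fin n → ℝ) : ℝ := ∑ j, p.1 j * x j + p.2

theorem affineVal_cons {n : ℕ} (p : (Fin (n + 1) → ℝ) × ℝ) (t : ℝ) (x : Fin n → ℝ) :
    affineVal p (Fin.cons t x) = p.1 0 * t + affineVal (Fin.tail p.1, p.2) x := by
  simp [affineVal, Fin.sum_univ_succ, Fin.tail, add_assoc]

theorem affineVal_comb {n : ℕ} (a b : ℝ) (p q : (Fin n → ℝ) × ℝ) (x : Fin n → ℝ) :
    affineVal (a • p + b • q) x = a * affineVal p x + b * affineVal q x := by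
  simp only [affineVal, Prod.fst_add, Prod.smul_fst, Prod.snd_add, Prod.smul_snd, Pi.add_apply,
    Pi.smul_apply, smul_eq_mul, add_mul, Finset.sum_add_distrib, mul_add, Finset.mul_sum, mul_assoc]
  ring

/-- If finitely many affine inequalities have no common solution, then they are violated by a
uniform amount. The proof eliminates the variables one at a time. -/
theorem exists_pos_le_affineVal {n : ℕ} {s : Set ((Fin n → ℝ) × ℝ)} (hs : s.Finite)
    (h : ∀ x, ∃ p ∈ s, 0 < affineVal p x) : ∃ ε > 0, ∀ x, ∃ p ∈ s, ε ≤ affineVal p x := by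
  induction n with
  | zero =>
    obtain ⟨p, hp, hpos⟩ := h 0
    exact ⟨_, hpos, fun x => ⟨p, hp, by rw [Subsingleton.elim x 0]⟩⟩
  | succ n ih =>
    let proj : (Fin (n + 1) → ℝ) × ℝ → (Fin n → ℝ) × ℝ := fun p => (Fin.tail p.1, p.2)
    -- The weights are positive, cancel the coordinate `0` and sum to one. By the last property a
    -- violation by `ε` of the combination forces one of `p`, `q` to be violated by the same `ε`.
    let comb : (Fin (n + 1) → ℝ) × ℝ → (Fin (n + 1) → ℝ) × ℝ → (Fin n → ℝ) × ℝ := fun p q =>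
      (-q.1 0 / (p.1 0 - q.1 0)) • proj p + (p.1 0 / (p.1 0 - q.1 0)) • proj q
    let s' := proj '' {p ∈ s | p.1 0 = 0} ∪ Set.image2 comb {p ∈ s | 0 < p.1 0} {q ∈ s | q.1 0 < 0}
    have hs' : s'.Finite :=
      ((hs.sep _).image _).union (Set.Finite.image2 _ (hs.sep _) (hs.sep _))
    have key : ∀ x, ∃ p ∈ s', 0 < affineVal p x := by
      intro x
      by_contra! hx
      -- If the eliminated system were satisfied at `x`, some coordinate `t` would extend `x` to a
      -- solution of the original one. Negative leading coefficients bound `t` below, positive ones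
      -- above.
      obtain ⟨t, ht₁, ht₂⟩ := exists_between_of_finite
        (L := (fun q => affineVal (proj q) x / -q.1 0) '' {q ∈ s | q.1 0 < 0})
        (U := (fun p => -affineVal (proj p) x / p.1 0) '' {p ∈ s | 0 < p.1 0})
        ((hs.sep _).image _) ((hs.sep _).image _) (by
          rintro _ ⟨q, ⟨hq, hq0⟩, rfl⟩ _ ⟨p, ⟨hp, hp0⟩, rfl⟩
          have := hx _ (Or.inr ⟨p, ⟨hp, hp0⟩, q, ⟨hq, hq0⟩, rfl⟩)
          rw [affineVal_comb] at this
          have hpq : 0 < p.1 0 - q.1 0 := by linarith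
          rw [div_mul_eq_mul_div, div_mul_eq_mul_div, ← add_div, div_le_iff₀ hpq] at this
          dsimp only
          rw [div_le_div_iff₀ (by linarith) hp0]
          linarith)
      obtain ⟨p, hp, hpos⟩ := h (Fin.cons t x)
      rw [affineVal_cons] at hpos
      rcases lt_trichotomy (p.1 0) 0 with h0 | h0 | h0
      · have := ht₁ _ ⟨p, ⟨hp, h0⟩, rfl⟩
        dsimp only at this
        rw [div_le_iff₀ (by linarith)] at this
        change affineVal (Fin.tail p.1, p.2) x ≤ _ at this
        linarith
      · have := hx _ (Or.inl ⟨p, ⟨hp, h0⟩, rfl⟩)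
        change affineVal (Fin.tail p.1, p.2) x ≤ _ at this
        rw [h0] at hpos
        linarith
      · have := ht₂ _ ⟨p, ⟨hp, h0⟩, rfl⟩
        dsimp only at this
        rw [le_div_iff₀ h0] at this
        change _ ≤ -affineVal (Fin.tail p.1, p.2) x at this
        linarith
    obtain ⟨ε, hε, hx⟩ := ih hs' key
    refine ⟨ε, hε, fun x => ?_⟩
    obtain ⟨_, ⟨p, ⟨hp, h0⟩, rfl⟩ | ⟨p, ⟨hp, hp0⟩, q, ⟨hq, hq0⟩, rfl⟩, hle⟩ := hx (Fin.tail x)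
    · refine ⟨p, hp, ?_⟩
      rw [← Fin.cons_self_tail x, affineVal_cons, h0]
      simpa using hle
    · by_contra! hcon
      have h₁ := hcon p hp
      have h₂ := hcon q hq
      rw [← Fin.cons_self_tail x, affineVal_cons] at h₁ h₂
      have hpq : 0 < p.1 0 - q.1 0 := by linarith
      rw [affineVal_comb, div_mul_eq_mul_div, div_mul_eq_mul_div, ← add_div, le_div_iff₀ hpq] at hle
      change _ ≤ -q.1 0 * affineVal (Fin.tail p.1, p.2) (Fin.tail x) +
        p.1 0 * affineVal (Fin.tail q.1, q.2) (Fin.tail x) at hle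
      nlinarith [mul_lt_mul_of_pos_left h₁ (neg_pos.mpr hq0), mul_lt_mul_of_pos_left h₂ hp0]

/-! ### Real-valued tropical rational functions -/

/-- `f` takes the real value `φ x` at each point `x`. -/
def Represents {n : ℕ} (f : RatFun n) (φ : (Fin n → ℝ) → ℝ) : Prop :=
  ∀ x, eval x f = real (φ x)

namespace Represents

variable {n : ℕ} {f g : RatFun n} {φ χ : (Fin n → ℝ) → ℝ}

theorem ne_zero (hf : Represents f φ) : f ≠ 0 := by
  rintro rfl
  exact real_ne_zero (φ 0) ((hf 0).symm.trans (map_zero _))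

theorem isUnit (hf : Represents f φ) : IsUnit f := RatFun.isUnit_of_ne_zero hf.ne_zero

theorem add (hf : Represents f φ) (hg : Represents g χ) :
    Represents (f + g) fun x => max (φ x) (χ x) := fun x => by
  rw [map_add, hf x, hg x, real_add_real]

theorem mul (hf : Represents f φ) (hg : Represents g χ) :
    Represents (f * g) fun x => φ x + χ x := fun x => by
  rw [map_mul, hf x, hg x, real_mul_real]

theorem inverse (hf : Represents f φ) : Represents f⁻¹ʳ fun x => -φ x := fun x => by
  have h : eval x f⁻¹ʳ * eval x f = real (-φ x) * eval x f := by
    rw [← map_mul, Ring.inverse_mul_cancel f hf.isUnit, map_one, hf x, real_mul_real,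
      neg_add_cancel, one_eq_real]
  exact (hf.isUnit.map (eval x)).mul_right_cancel h

theorem min (hf : Represents f φ) (hg : Represents g χ) :
    Represents (f⁻¹ʳ + g⁻¹ʳ)⁻¹ʳ fun x => Min.min (φ x) (χ x) := fun x => by
  rw [(hf.inverse.add hg.inverse).inverse x]
  exact congrArg real (by dsimp only; rw [max_neg_neg, neg_neg])

end Represents

theorem exists_represents {n : ℕ} {f : RatFun n} (hf : f ≠ 0) : ∃ φ, Represents f φ := by
  choose φ hφ using fun x =>
    exists_real ((RatFun.isUnit_of_ne_zero hf).map (eval x)).ne_zero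
  exact ⟨φ, hφ⟩

theorem eval_algebraMap_laurentFun {n : ℕ} (x : Fin n → ℝ) (F : LaurentFun n) :
    eval x (algebraMap (LaurentFun n) (RatFun n) F) = evalLaurentFun x F :=
  IsLocalization.lift_eq _ _

theorem represents_algebraMap {n : ℕ} (a : ℝ) :
    Represents (algebraMap MaxTrop (RatFun n) (real a)) fun _ => a := fun x => by
  rw [IsScalarTower.algebraMap_apply MaxTrop (LaurentFun n) (RatFun n),
    eval_algebraMap_laurentFun]
  exact (evalLaurent x).commutes (real a)

/-- Affine functions with integer linear part are tropical rational functions. -/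
theorem exists_represents_affine {n : ℕ} (i : Fin n → ℤ) (c : ℝ) :
    ∃ f : RatFun n, Represents f fun x => affineVal (fun j => (i j : ℝ), c) x := by
  refine ⟨algebraMap (LaurentFun n) (RatFun n)
    ((sameValues n).mk' (AddMonoidAlgebra.single i (real c))), fun x => ?_⟩
  rw [eval_algebraMap_laurentFun]
  change evalLaurent x (AddMonoidAlgebra.single i (real c)) = _
  rw [evalLaurent, AddMonoidAlgebra.lift_single, smul_eq_mul]
  exact congrArg real (add_comm _ _)

/-- Recording an index that attains the maximum gives both its value and the bound on all other
members of the family. -/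
theorem exists_represents_max {n : ℕ} {ι : Type*} {s : Set ι} (hs : s.Finite) (hne : s.Nonempty)
    {φ : ι → (Fin n → ℝ) → ℝ} (hφ : ∀ i ∈ s, ∃ f : RatFun n, Represents f (φ i)) :
    ∃ (f : RatFun n) (χ : (Fin n → ℝ) → ℝ), Represents f χ ∧
      ∀ x, ∃ i ∈ s, χ x = φ i x ∧ ∀ k ∈ s, φ k x ≤ φ i x := by
  induction s, hs using Set.Finite.induction_on with
  | empty => exact absurd hne Set.not_nonempty_empty
  | @insert a s ha hs ih =>
    obtain ⟨g, hg⟩ := hφ a (Set.mem_insert _ _)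
    rcases s.eq_empty_or_nonempty with rfl | hne'
    · exact ⟨g, φ a, hg, fun x => ⟨a, by simp, rfl, by simp⟩⟩
    obtain ⟨f, χ, hf, hχ⟩ := ih hne' fun i hi => hφ i (Set.mem_insert_of_mem _ hi)
    refine ⟨_, _, hg.add hf, fun x => ?_⟩
    obtain ⟨i, hi, hix, hmax⟩ := hχ x
    rcases le_total (φ a x) (χ x) with hle | hle
    · refine ⟨i, Set.mem_insert_of_mem _ hi, by rw [max_eq_right hle, hix], ?_⟩
      rintro k (rfl | hk)
      · exact hle.trans hix.le
      · exact hmax k hk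
    · refine ⟨a, Set.mem_insert _ _, max_eq_left hle, ?_⟩
      rintro k (rfl | hk)
      · exact le_rfl
      · exact (hmax k hk).trans (hix.ge.trans hle)

theorem exists_represents_min {n : ℕ} {ι : Type*} {s : Set ι} (hs : s.Finite) (hne : s.Nonempty)
    {φ : ι → (Fin n → ℝ) → ℝ} (hφ : ∀ i ∈ s, ∃ f : RatFun n, Represents f (φ i)) :
    ∃ (f : RatFun n) (χ : (Fin n → ℝ) → ℝ), Represents f χ ∧
      ∀ x, ∃ i ∈ s, χ x = φ i x ∧ ∀ k ∈ s, φ i x ≤ φ k x := by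
  obtain ⟨f, χ, hf, hχ⟩ := exists_represents_max hs hne (φ := fun i x => -φ i x)
    fun i hi => (hφ i hi).imp' _ fun f hf => Represents.inverse hf
  refine ⟨_, _, hf.inverse, fun x => ?_⟩
  obtain ⟨i, hi, hix, hmax⟩ := hχ x
  exact ⟨i, hi, by rw [hix, neg_neg], fun k hk => neg_le_neg_iff.mp (hmax k hk)⟩

/-! ### Laurent polynomials as maxima of affine functions -/

theorem sum_real_eq {ι : Type*} {s : Finset ι} {φ : ι → ℝ} {i : ι} (hi : i ∈ s)
    (hmax : ∀ k ∈ s, φ k ≤ φ i) : ∑ k ∈ s, real (φ k) = real (φ i) := by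
  classical
  have h : ∀ t : Finset ι, (∀ k ∈ t, φ k ≤ φ i) → ∑ k ∈ t, real (φ k) + real (φ i) = real (φ i) := by
    intro t
    induction t using Finset.induction_on with
    | empty => simp
    | insert a t ha ih =>
      intro ht
      rw [Finset.sum_insert ha, add_assoc, ih fun k hk => ht k (Finset.mem_insert_of_mem hk),
        real_add_real, max_eq_right (ht a (Finset.mem_insert_self _ _))]
  rw [← Finset.sum_erase_add _ _ hi]
  exact h _ fun k hk => hmax k (Finset.mem_of_mem_erase hk)

theorem exists_continuous_sum_real {X ι : Type*} [TopologicalSpace X] {s : Finset ι}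
    (hs : s.Nonempty) {φ : ι → X → ℝ} (hφ : ∀ i, Continuous (φ i)) :
    ∃ χ : X → ℝ, Continuous χ ∧ ∀ x, ∑ i ∈ s, real (φ i x) = real (χ x) := by
  refine ⟨fun x => s.sup' hs fun i => φ i x,
    Continuous.finset_sup'_apply hs fun i _ => hφ i, fun x => ?_⟩
  obtain ⟨i, hi, h⟩ := s.exists_mem_eq_sup' hs fun i => φ i x
  rw [sum_real_eq hi fun k hk => h ▸ Finset.le_sup' (fun i => φ i x) hk]
  exact congrArg real h.symm

theorem continuous_affineVal {n : ℕ} (p : (Fin n → ℝ) × ℝ) : Continuous (affineVal p) := by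
  unfold affineVal
  fun_prop

/-- A tropical Laurent polynomial is a maximum of affine functions with integer linear parts. -/
theorem exists_evalLaurent_eq_sum {n : ℕ} (P : LaurentPoly n) :
    ∃ c : (Fin n → ℤ) → ℝ, ∀ x,
      evalLaurent x P = ∑ i ∈ P.coeff.support, real (affineVal (fun j => (i j : ℝ), c i) x) := by
  have hc : ∀ i, ∃ c, i ∈ P.coeff.support → P.coeff i = real c := fun i => by
    by_cases hi : i ∈ P.coeff.support
    · exact (exists_real (Finsupp.mem_support_iff.mp hi)).imp fun _ h _ => h
    · exact ⟨0, fun h => absurd h hi⟩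
  choose c hc using hc
  refine ⟨c, fun x => ?_⟩
  rw [evalLaurent, AddMonoidAlgebra.lift_apply', Finsupp.sum]
  refine Finset.sum_congr rfl fun i hi => ?_
  rw [affineVal, add_comm, ← real_mul_real, ← hc i hi]
  rfl

/-- Clearing the denominator reduces continuity and equality of values to Laurent polynomials. -/
theorem exists_laurentPoly_mul_eq {n : ℕ} (f : RatFun n) :
    ∃ P Q : LaurentPoly n, Q ≠ 0 ∧ ∀ x, eval x f * evalLaurent x Q = evalLaurent x P := by
  obtain ⟨⟨F, G⟩, rfl⟩ := IsLocalization.mk'_surjective (nonZeroDivisors (LaurentFun n)) f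
  obtain ⟨G, hG⟩ := G
  induction F using Quotient.inductionOn' with
  | h P =>
    induction G using Quotient.inductionOn' with
    | h Q =>
      refine ⟨P, Q, ?_, fun x => ?_⟩
      · rintro rfl
        exact nonZeroDivisors.ne_zero hG rfl
      · have := congrArg (eval x) (IsLocalization.mk'_spec (M := nonZeroDivisors (LaurentFun n))
          (RatFun n) ((sameValues n).mk' P) ⟨(sameValues n).mk' Q, hG⟩)
        rw [map_mul, eval_algebraMap_laurentFun, eval_algebraMap_laurentFun] at this
        exact this

theorem exists_continuous_evalLaurent {n : ℕ} {P : LaurentPoly n} (hP : P ≠ 0) :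
    ∃ χ : (Fin n → ℝ) → ℝ, Continuous χ ∧ ∀ x, evalLaurent x P = real (χ x) := by
  obtain ⟨c, hc⟩ := exists_evalLaurent_eq_sum P
  simp only [hc]
  refine exists_continuous_sum_real ?_ fun i => continuous_affineVal _
  rw [Finsupp.support_nonempty_iff]
  intro h
  exact hP (by ext i; rw [h]; rfl)

theorem Represents.continuous {n : ℕ} {f : RatFun n} {φ : (Fin n → ℝ) → ℝ}
    (hf : Represents f φ) : Continuous φ := by
  obtain ⟨P, Q, hQ, hPQ⟩ := exists_laurentPoly_mul_eq f
  obtain ⟨q, hq, hQq⟩ := exists_continuous_evalLaurent hQ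
  have hP : P ≠ 0 := by
    rintro rfl
    have := hPQ 0
    rw [hf 0, hQq 0, real_mul_real, map_zero] at this
    exact real_ne_zero _ this
  obtain ⟨p, hp, hPp⟩ := exists_continuous_evalLaurent hP
  have : φ = fun x => p x - q x := by
    funext x
    have := hPQ x
    rw [hf x, hQq x, hPp x, real_mul_real] at this
    linarith [real_injective this]
  rw [this]
  exact hp.sub hq

/-! ### Polyhedral cells -/

/-- Affine functions whose linear part is integral. -/
def IsIntegral {n : ℕ} (p : (Fin n → ℝ) × ℝ) : Prop := ∃ i : Fin n → ℤ, p.1 = fun j => (i j : ℝ)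

/-- The cell of `x` cut out by the order in which the affine functions of `M` appear at `x`. -/
def cell {n : ℕ} (M : Set ((Fin n → ℝ) × ℝ)) (x : Fin n → ℝ) : Set (Fin n → ℝ) :=
  {y | ∀ u ∈ M, ∀ v ∈ M, affineVal u x ≤ affineVal v x → affineVal u y ≤ affineVal v y}

/-- Take for `M` the monomials of both polynomials. Those maximal at `x` stay maximal on the cell of
`x`, so there each polynomial is a single affine function, and their equality at `x` is two
inequalities that the cell preserves. A polynomial that is `-∞` at one point is zero, which settles
the degenerate cases. -/
theorem exists_cell_evalLaurent {n : ℕ} (P Q : LaurentPoly n) :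
    ∃ M : Set ((Fin n → ℝ) × ℝ), M.Finite ∧ (∀ p ∈ M, IsIntegral p) ∧
      ∀ x, ∀ y ∈ cell M x, evalLaurent x P = evalLaurent x Q → evalLaurent y P = evalLaurent y Q := by
  by_cases hP : P = 0
  · subst hP
    refine ⟨∅, Set.finite_empty, by simp, fun x y _ h => ?_⟩
    rw [map_zero] at h ⊢
    rw [evalLaurent_eq_zero h.symm, map_zero]
  by_cases hQ : Q = 0
  · subst hQ
    refine ⟨∅, Set.finite_empty, by simp, fun x y _ h => ?_⟩
    rw [map_zero] at h ⊢
    rw [evalLaurent_eq_zero h, map_zero]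
  obtain ⟨c, hc⟩ := exists_evalLaurent_eq_sum P
  obtain ⟨d, hd⟩ := exists_evalLaurent_eq_sum Q
  have hne : ∀ {P : LaurentPoly n}, P ≠ 0 → P.coeff.support.Nonempty := fun {P} hP => by
    rw [Finsupp.support_nonempty_iff]
    intro h
    exact hP (by ext i; rw [h]; rfl)
  let u : (Fin n → ℤ) → (Fin n → ℝ) × ℝ := fun i => (fun j => (i j : ℝ), c i)
  let v : (Fin n → ℤ) → (Fin n → ℝ) × ℝ := fun i => (fun j => (i j : ℝ), d i)
  have hc' : ∀ x, evalLaurent x P = ∑ i ∈ P.coeff.support, real (affineVal (u i) x) := hc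
  have hd' : ∀ x, evalLaurent x Q = ∑ i ∈ Q.coeff.support, real (affineVal (v i) x) := hd
  refine ⟨u '' P.coeff.support ∪ v '' Q.coeff.support,
    (Set.toFinite _).union (Set.toFinite _), ?_, fun x y hy h => ?_⟩
  · rintro _ (⟨i, -, rfl⟩ | ⟨i, -, rfl⟩) <;> exact ⟨i, rfl⟩
  obtain ⟨i, hi, himax⟩ := Finset.exists_max_image _ (fun i => affineVal (u i) x) (hne hP)
  obtain ⟨k, hk, hkmax⟩ := Finset.exists_max_image _ (fun i => affineVal (v i) x) (hne hQ)
  have hmP : ∀ i ∈ P.coeff.support, u i ∈ u '' P.coeff.support ∪ v '' Q.coeff.support :=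
    fun i hi => Or.inl ⟨i, hi, rfl⟩
  have hmQ : ∀ i ∈ Q.coeff.support, v i ∈ u '' P.coeff.support ∪ v '' Q.coeff.support :=
    fun i hi => Or.inr ⟨i, hi, rfl⟩
  rw [hc', hd', sum_real_eq (φ := fun i => affineVal (u i) x) hi himax,
    sum_real_eq (φ := fun i => affineVal (v i) x) hk hkmax] at h
  have hx := real_injective h
  rw [hc', hd',
    sum_real_eq (φ := fun i => affineVal (u i) y) hi fun l hl =>
      hy _ (hmP l hl) _ (hmP i hi) (himax l hl),
    sum_real_eq (φ := fun i => affineVal (v i) y) hk fun l hl =>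
      hy _ (hmQ l hl) _ (hmQ k hk) (hkmax l hl)]
  exact congrArg real (le_antisymm (hy _ (hmP i hi) _ (hmQ k hk) hx.le)
    (hy _ (hmQ k hk) _ (hmP i hi) hx.ge))

theorem exists_cell_eval {n : ℕ} (f g : RatFun n) :
    ∃ M : Set ((Fin n → ℝ) × ℝ), M.Finite ∧ (∀ p ∈ M, IsIntegral p) ∧
      ∀ x, ∀ y ∈ cell M x, eval x f = eval x g → eval y f = eval y g := by
  obtain ⟨P, Q, hQ, hf⟩ := exists_laurentPoly_mul_eq f
  obtain ⟨P', Q', hQ', hg⟩ := exists_laurentPoly_mul_eq g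
  obtain ⟨M, hM, hint, hcell⟩ := exists_cell_evalLaurent (P * Q') (P' * Q)
  have hu : ∀ {Q : LaurentPoly n}, Q ≠ 0 → ∀ x, IsUnit (evalLaurent x Q) := fun hQ x =>
    isUnit_of_ne_zero fun h => hQ (evalLaurent_eq_zero h)
  have key : ∀ x, eval x f = eval x g ↔ evalLaurent x (P * Q') = evalLaurent x (P' * Q) := by
    intro x
    rw [map_mul, map_mul, ← hf, ← hg, mul_right_comm, (hu hQ x).mul_left_inj,
      (hu hQ' x).mul_left_inj]
  exact ⟨M, hM, hint, fun x y hy => by rw [key, key]; exact hcell x y hy⟩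

theorem cell_subset_cell {n : ℕ} {M N : Set ((Fin n → ℝ) × ℝ)} (h : N ⊆ M) (x : Fin n → ℝ) :
    cell M x ⊆ cell N x :=
  fun _ hy u hu v hv => hy u (h hu) v (h hv)

theorem mem_cell {n : ℕ} (M : Set ((Fin n → ℝ) × ℝ)) (x : Fin n → ℝ) : x ∈ cell M x :=
  fun _ _ _ _ h => h

theorem affineVal_add_smul {n : ℕ} (p : (Fin n → ℝ) × ℝ) {a b : ℝ} (hab : a + b = 1)
    (x y : Fin n → ℝ) : affineVal p (a • x + b • y) = a * affineVal p x + b * affineVal p y := by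
  have hb : b = 1 - a := by linarith
  subst hb
  simp only [affineVal, Pi.add_apply, Pi.smul_apply, smul_eq_mul, mul_add, Finset.sum_add_distrib,
    Finset.mul_sum, mul_left_comm]
  ring

theorem convex_cell {n : ℕ} (M : Set ((Fin n → ℝ) × ℝ)) (x : Fin n → ℝ) : Convex ℝ (cell M x) := by
  intro y hy z hz a b ha hb hab u hu v hv h
  rw [affineVal_add_smul u hab, affineVal_add_smul v hab]
  exact add_le_add (mul_le_mul_of_nonneg_left (hy u hu v hv h) ha)
    (mul_le_mul_of_nonneg_left (hz u hu v hv h) hb)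

theorem affineVal_sub {n : ℕ} (p q : (Fin n → ℝ) × ℝ) (x : Fin n → ℝ) :
    affineVal (p - q) x = affineVal p x - affineVal q x := by
  have := affineVal_comb 1 (-1) p q x
  rwa [one_smul, neg_one_smul, ← sub_eq_add_neg, one_mul, neg_one_mul, ← sub_eq_add_neg] at this

/-- Integrality of the slopes is what makes the inequalities that define a cell available as
rational functions. -/
theorem IsIntegral.exists_represents_sub {n : ℕ} {p q : (Fin n → ℝ) × ℝ} (hp : IsIntegral p)
    (hq : IsIntegral q) : ∃ f : RatFun n, Represents f (affineVal (p - q)) := by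
  obtain ⟨p, c⟩ := p
  obtain ⟨q, d⟩ := q
  obtain ⟨i, rfl : p = _⟩ := hp
  obtain ⟨k, rfl : q = _⟩ := hq
  obtain ⟨f, hf⟩ := exists_represents_affine (i - k) (c - d)
  refine ⟨f, fun x => (hf x).trans (congrArg real ?_)⟩
  exact congrArg (affineVal · x) (Prod.ext (by ext j; simp) rfl)

/-! ### Separation of disjoint cells -/

/-- The order in which the affine functions of `M` appear at `x`. -/
def cellRel {n : ℕ} (M : Set ((Fin n → ℝ) × ℝ)) (x : Fin n → ℝ) :
    Set (((Fin n → ℝ) × ℝ) × ((Fin n → ℝ) × ℝ)) :=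
  {p ∈ M ×ˢ M | affineVal (p.1 - p.2) x ≤ 0}

theorem mem_cell_iff {n : ℕ} {M : Set ((Fin n → ℝ) × ℝ)} {x y : Fin n → ℝ} :
    y ∈ cell M x ↔ ∀ p ∈ cellRel M x, affineVal (p.1 - p.2) y ≤ 0 := by
  simp only [cell, cellRel, affineVal_sub, sub_nonpos]
  exact ⟨fun h p hp => h _ hp.1.1 _ hp.1.2 hp.2, fun h u hu v hv huv => h (u, v) ⟨⟨hu, hv⟩, huv⟩⟩

/-- A cell depends only on a subset of `M ×ˢ M`, so even an infinite set of points has finitely many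
cells. -/
theorem finite_image_cellRel {n : ℕ} {M : Set ((Fin n → ℝ) × ℝ)} (hM : M.Finite)
    (A : Set (Fin n → ℝ)) : (cellRel M '' A).Finite := by
  refine (hM.prod hM).finite_subsets.subset ?_
  rintro _ ⟨x, -, rfl⟩
  exact Set.sep_subset _ _

/-- The inequalities of both cells together are infeasible, hence violated uniformly. On the second
cell its own inequalities hold, so the violated one belongs to the first. -/
theorem exists_pos_le_of_disjoint_cell {n : ℕ} {M : Set ((Fin n → ℝ) × ℝ)} (hM : M.Finite)
    {x y : Fin n → ℝ} (h : Disjoint (cell M x) (cell M y)) :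
    ∃ ε > 0, ∀ z ∈ cell M y, ∃ p ∈ cellRel M x, ε ≤ affineVal (p.1 - p.2) z := by
  have hfin : ∀ x, (cellRel M x).Finite := fun x => (hM.prod hM).sep _
  obtain ⟨ε, hε, hz⟩ := exists_pos_le_affineVal
    (s := (fun p => p.1 - p.2) '' (cellRel M x ∪ cellRel M y))
    (((hfin x).union (hfin y)).image _) (by
      intro z
      by_contra! hz
      exact Set.disjoint_left.mp h
        (mem_cell_iff.mpr fun p hp => hz _ ⟨p, Or.inl hp, rfl⟩)
        (mem_cell_iff.mpr fun p hp => hz _ ⟨p, Or.inr hp, rfl⟩))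
  refine ⟨ε, hε, fun z hzy => ?_⟩
  obtain ⟨_, ⟨p, hp | hp, rfl⟩, hle⟩ := hz z
  · exact ⟨p, hp, hle⟩
  · exact absurd (mem_cell_iff.mp hzy p hp) (not_le.mpr (hε.trans_le hle))

/-- Two sets of points whose cells are pairwise disjoint are separated by a tropical rational
function. -/
theorem exists_represents_separating {n : ℕ} {M : Set ((Fin n → ℝ) × ℝ)} (hM : M.Finite)
    (hint : ∀ p ∈ M, IsIntegral p) {A B : Set (Fin n → ℝ)} (hA : A.Nonempty) (hB : B.Nonempty)
    (hdisj : ∀ x ∈ A, ∀ y ∈ B, Disjoint (cell M x) (cell M y)) :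
    ∃ (f : RatFun n) (φ : (Fin n → ℝ) → ℝ), Represents f φ ∧
      (∀ x ∈ A, φ x ≤ 0) ∧ ∃ ε > 0, ∀ y ∈ B, ε ≤ φ y := by
  -- The functions are indexed by the relations `R`, not by the points of `A`, so that a finite
  -- minimum can be taken. Disjointness from the cell of some `y ∈ B` shows that `R` is nonempty.
  have hmax : ∀ R ∈ cellRel M '' A, ∃ χ : (Fin n → ℝ) → ℝ, (∃ f : RatFun n, Represents f χ) ∧
      ∀ x, ∃ p ∈ R, χ x = affineVal (p.1 - p.2) x ∧
        ∀ q ∈ R, affineVal (q.1 - q.2) x ≤ affineVal (p.1 - p.2) x := by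
    rintro _ ⟨x, hx, rfl⟩
    obtain ⟨y, hy⟩ := hB
    obtain ⟨ε, -, hε⟩ := exists_pos_le_of_disjoint_cell hM (hdisj x hx y hy)
    obtain ⟨p, hp, -⟩ := hε y (mem_cell M y)
    obtain ⟨f, χ, hf, hχ⟩ := exists_represents_max (s := cellRel M x) ((hM.prod hM).sep _) ⟨p, hp⟩
      (φ := fun p => affineVal (p.1 - p.2))
      fun q hq => (hint _ hq.1.1).exists_represents_sub (hint _ hq.1.2)
    exact ⟨χ, ⟨f, hf⟩, hχ⟩
  choose! χ hχrep hχ using hmax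
  obtain ⟨f, φ, hf, hφ⟩ := exists_represents_min (finite_image_cellRel hM A) (hA.image _) hχrep
  refine ⟨f, φ, hf, fun x hx => ?_, ?_⟩
  · obtain ⟨R, -, hφR, hmin⟩ := hφ x
    obtain ⟨p, hp, hpx, -⟩ := hχ _ (Set.mem_image_of_mem (cellRel M) hx) x
    exact hφR.trans_le ((hmin _ (Set.mem_image_of_mem _ hx)).trans (hpx.trans_le hp.2))
  -- There are finitely many pairs of cells, and each gap persists when `ε` shrinks, so one `ε`
  -- serves them all.
  · have hev : ∀ᶠ ε in nhdsWithin (0 : ℝ) (Set.Ioi 0), ∀ R ∈ cellRel M '' A,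
        ∀ T ∈ cellRel M '' B, ∀ z, cellRel M z = T → ∃ p ∈ R, ε ≤ affineVal (p.1 - p.2) z := by
      rw [Filter.eventually_all_finite (finite_image_cellRel hM A)]
      rintro _ ⟨x, hx, rfl⟩
      rw [Filter.eventually_all_finite (finite_image_cellRel hM B)]
      rintro _ ⟨y, hy, rfl⟩
      obtain ⟨ε, hε, h⟩ := exists_pos_le_of_disjoint_cell hM (hdisj x hx y hy)
      filter_upwards [Ioc_mem_nhdsGT hε] with δ hδ z hz
      obtain ⟨p, hp, hle⟩ := h z (mem_cell_iff.mpr fun p hp => by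
        rw [← hz] at hp
        exact hp.2)
      exact ⟨p, hp, hδ.2.trans hle⟩
    obtain ⟨ε, h, hε⟩ := (hev.and self_mem_nhdsWithin).exists
    refine ⟨ε, hε, fun y hy => ?_⟩
    obtain ⟨R, hR, hφR, -⟩ := hφ y
    obtain ⟨q, hq, hle⟩ := h R hR _ (Set.mem_image_of_mem _ hy) y rfl
    obtain ⟨p, -, hp, hmax⟩ := hχ R hR y
    rw [hφR, hp]
    exact hle.trans (hmax q hq)

/-! ### Disconnected varieties -/

/-- The variety of a finitely generated congruence is a union of cells of a finite family. -/
theorem exists_cell_subset_congruenceVariety {n : ℕ} {E : RingCon (RatFun n)}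
    (hE : CongruenceFG E) : ∃ M : Set ((Fin n → ℝ) × ℝ), M.Finite ∧ (∀ p ∈ M, IsIntegral p) ∧
      ∀ x ∈ congruenceVariety E, cell M x ⊆ congruenceVariety E := by
  obtain ⟨t, rfl⟩ := hE
  choose M hM hint hcell using fun p : RatFun n × RatFun n => exists_cell_eval p.1 p.2
  refine ⟨⋃ p ∈ t, M p, t.finite_toSet.biUnion fun p _ => hM p, ?_, fun x hx y hy => ?_⟩
  · simp only [Set.mem_iUnion]
    rintro q ⟨p, -, hq⟩
    exact hint p q hq
  -- Agreement at `y` is itself a congruence, so it need only be checked on the generators; these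
  -- agree at `x`, and the cell carries this to `y`.
  · have hle : ringConGen (fun a b => (a, b) ∈ t) ≤ RingCon.ker (eval y) :=
      RingCon.ringConGen_le.mpr fun a b hab =>
        hcell (a, b) x y (cell_subset_cell (Set.subset_biUnion_of_mem (u := M) hab) x hy)
          (hx a b (RingCon.ringConGen_le.mp le_rfl a b hab))
    exact fun f g hfg => hle hfg

theorem exists_represents_of_not_isPreconnected {n : ℕ} {E : RingCon (RatFun n)}
    (hE : CongruenceFG E) (hV : ¬ IsPreconnected (congruenceVariety E)) :
    ∃ (f : RatFun n) (φ : (Fin n → ℝ) → ℝ), Represents f φ ∧ ∃ ε > 0,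
      (∀ x ∈ congruenceVariety E, φ x ≤ 0 ∨ ε ≤ φ x) ∧
      (∃ x ∈ congruenceVariety E, φ x ≤ 0) ∧ ∃ x ∈ congruenceVariety E, ε ≤ φ x := by
  obtain ⟨M, hM, hint, hcell⟩ := exists_cell_subset_congruenceVariety hE
  set V := congruenceVariety E
  simp only [IsPreconnected, not_forall] at hV
  obtain ⟨u, v, hu, hv, hVuv, hVu, hVv, hne⟩ := hV
  have hdisj : ∀ x ∈ V ∩ u, ∀ y ∈ V ∩ v, Disjoint (cell M x) (cell M y) := by
    intro x hx y hy
    rw [Set.disjoint_left]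
    intro z hzx hzy
    -- A cell in `V` is convex, hence connected, so it cannot meet both open sets of the
    -- disconnection.
    have aux : ∀ x ∈ V, ¬ ((cell M x ∩ u).Nonempty ∧ (cell M x ∩ v).Nonempty) := by
      rintro x hx ⟨h₁, h₂⟩
      exact hne (((convex_cell M x).isPreconnected u v hu hv ((hcell x hx).trans hVuv) h₁ h₂).mono
        (Set.inter_subset_inter_left _ (hcell x hx)))
    rcases hVuv (hcell x hx.1 hzx) with hz | hz
    · exact aux y hy.1 ⟨⟨z, hzy, hz⟩, ⟨y, mem_cell M y, hy.2⟩⟩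
    · exact aux x hx.1 ⟨⟨x, mem_cell M x, hx.2⟩, ⟨z, hzx, hz⟩⟩
  obtain ⟨f, φ, hf, hA, ε, hε, hB⟩ := exists_represents_separating hM hint hVu hVv hdisj
  exact ⟨f, φ, hf, ε, hε, fun x hx => (hVuv hx).imp (fun h => hA x ⟨hx, h⟩) fun h => hB x ⟨hx, h⟩,
    hVu.imp fun x hx => ⟨hx.1, hA x hx⟩, hVv.imp fun x hx => ⟨hx.1, hB x hx⟩⟩

/-! ### The conditions in `S` as conditions on values -/

/-- The tropical identity that expresses that the value `t` avoids the interval `(a₃, a₁)`. -/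
theorem max_add_min_eq_iff {t a₁ a₂ a₃ : ℝ} (h₃₂ : a₃ < a₂) (h₂₁ : a₂ < a₁)
    (h : a₁ - a₂ = a₂ - a₃) :
    max t a₁ + min t a₂ = a₁ + -a₂ + max t a₂ + min t a₃ ↔ t ≤ a₃ ∨ a₁ ≤ t := by
  -- Left minus right is the tent `max 0 (min (t - a₃) (a₁ - t))`. Equal spacing puts its peak at
  -- `a₂` and makes it vanish for `t ≥ a₁`.
  rcases le_total t a₁ with h₁ | h₁ <;> rcases le_total t a₂ with h₂ | h₂ <;>
    rcases le_total t a₃ with h₃ | h₃ <;> simp only [h₁, h₂, h₃, max_eq_left, max_eq_right,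
      min_eq_left, min_eq_right, true_or, or_true, iff_true] <;> try linarith
  · exact ⟨fun h => Or.inl (by linarith), fun h => by rcases h with h | h <;> linarith⟩
  · exact ⟨fun h => Or.inr (by linarith), fun h => by rcases h with h | h <;> linarith⟩

section Conditions

variable {n : ℕ} {S : Type*} [CommSemiring S] [Algebra MaxTrop S] {ψ : RatFun n →ₐ[MaxTrop] S}
  {V : Set (Fin n → ℝ)}

theorem map_eq_map_iff (hE : kerCongruence ψ = congruenceOf V) {f g : RatFun n}
    {φ χ : (Fin n → ℝ) → ℝ} (hf : Represents f φ) (hg : Represents g χ) :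
    ψ f = ψ g ↔ ∀ x ∈ V, φ x = χ x := by
  have : ψ f = ψ g ↔ ∀ x ∈ V, eval x f = eval x g :=
    iff_of_eq (congrArg (fun E : RingCon (RatFun n) => E f g) hE)
  simp only [this, hf _, hg _, real_injective.eq_iff]

/-- A real value never equals `-∞`, so such an `f` can agree with zero only on the empty set. -/
theorem map_eq_zero_iff_of_represents (hE : kerCongruence ψ = congruenceOf V) {f : RatFun n}
    {φ : (Fin n → ℝ) → ℝ} (hf : Represents f φ) : ψ f = 0 ↔ V = ∅ := by
  have : ψ f = ψ 0 ↔ ∀ x ∈ V, eval x f = eval x 0 :=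
    iff_of_eq (congrArg (fun E : RingCon (RatFun n) => E f 0) hE)
  rw [map_zero] at this
  simp only [this, hf _, map_zero, real_ne_zero, imp_false, Set.eq_empty_iff_forall_notMem]

theorem Represents.map_inverse (ψ : RatFun n →ₐ[MaxTrop] S) {f : RatFun n}
    {φ : (Fin n → ℝ) → ℝ} (hf : Represents f φ) : ψ f⁻¹ʳ = (ψ f)⁻¹ʳ := by
  have hu : IsUnit (ψ f) := hf.isUnit.map (ψ : RatFun n →+* S)
  refine hu.mul_right_cancel ?_
  rw [← map_mul, Ring.inverse_mul_cancel f hf.isUnit, map_one, Ring.inverse_mul_cancel _ hu]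

theorem map_min (ψ : RatFun n →ₐ[MaxTrop] S) {f g : RatFun n} {φ χ : (Fin n → ℝ) → ℝ}
    (hf : Represents f φ) (hg : Represents g χ) :
    ((ψ f)⁻¹ʳ + (ψ g)⁻¹ʳ)⁻¹ʳ = ψ (f⁻¹ʳ + g⁻¹ʳ)⁻¹ʳ := by
  rw [(hf.inverse.add hg.inverse).map_inverse, map_add, hf.map_inverse, hg.map_inverse]

/-- Every expression in `S` is the image of the same expression in rational functions, where the
double inverse is a minimum. The first two conditions say that `max φ a₃` and `min φ a₁` differ from
`φ` somewhere on `V`. -/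
theorem separation_conditions_iff (hE : kerCongruence ψ = congruenceOf V) {f : RatFun n}
    {φ : (Fin n → ℝ) → ℝ} (hf : Represents f φ) {a₁ a₂ a₃ : ℝ} (h₃₂ : a₃ < a₂) (h₂₁ : a₂ < a₁)
    (h : a₁ - a₂ = a₂ - a₃) :
    (ψ f ≠ ψ f + cst S a₃ ∧ ψ f ≠ ((ψ f)⁻¹ʳ + (cst S a₁)⁻¹ʳ)⁻¹ʳ ∧
      (ψ f + cst S a₁) * ((ψ f)⁻¹ʳ + (cst S a₂)⁻¹ʳ)⁻¹ʳ =
        (cst S a₁ * (cst S a₂)⁻¹ʳ) * (ψ f + cst S a₂) * ((ψ f)⁻¹ʳ + (cst S a₃)⁻¹ʳ)⁻¹ʳ) ↔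
      (∃ x ∈ V, φ x < a₃) ∧ (∃ x ∈ V, a₁ < φ x) ∧ ∀ x ∈ V, φ x ≤ a₃ ∨ a₁ ≤ φ x := by
  have hc : ∀ a, cst S a = ψ (algebraMap MaxTrop (RatFun n) (real a)) := fun a =>
    (ψ.commutes _).symm
  have ha : ∀ a, Represents (algebraMap MaxTrop (RatFun n) (real a)) fun _ => a :=
    represents_algebraMap
  have hinv : ∀ a, (ψ (algebraMap MaxTrop (RatFun n) (real a)))⁻¹ʳ =
      ψ (algebraMap MaxTrop (RatFun n) (real a))⁻¹ʳ := fun a =>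
    ((ha a).map_inverse ψ).symm
  simp only [hc, map_min ψ hf (ha _)]
  rw [hinv]
  simp only [← map_add, ← map_mul]
  refine and_congr ?_ (and_congr ?_ ?_)
  · rw [ne_eq, map_eq_map_iff hE hf (hf.add (ha a₃))]
    simp
  · rw [ne_eq, map_eq_map_iff hE hf (hf.min (ha a₁))]
    simp
  · rw [map_eq_map_iff hE ((hf.add (ha a₁)).mul (hf.min (ha a₂)))
      ((((ha a₁).mul (ha a₂).inverse).mul (hf.add (ha a₂))).mul (hf.min (ha a₃)))]
    exact forall₂_congr fun x _ => max_add_min_eq_iff h₃₂ h₂₁ h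

end Conditions

end TropicalVariety

theorem proposition4p1p4 (n : ℕ) {S : Type*} [CommSemiring S]
    [Algebra TropicalVariety.MaxTrop S]
    (ψ : TropicalVariety.RatFun n →ₐ[TropicalVariety.MaxTrop] S)
    (hψ : Function.Surjective ψ)
    (hfg : TropicalVariety.CongruenceFG (TropicalVariety.kerCongruence ψ))
    (hE : TropicalVariety.kerCongruence ψ =
      TropicalVariety.congruenceOf
        (TropicalVariety.congruenceVariety (TropicalVariety.kerCongruence ψ))) :
    ((TropicalVariety.congruenceVariety (TropicalVariety.kerCongruence ψ)).Nonempty ∧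
        ¬ IsConnected (TropicalVariety.congruenceVariety (TropicalVariety.kerCongruence ψ))) ↔
      ∃ (s : S) (a₁ a₂ a₃ : ℝ),
        s ≠ 0 ∧ a₃ < a₂ ∧ a₂ < a₁ ∧ a₁ - a₂ = a₂ - a₃ ∧
        s ≠ s + TropicalVariety.cst S a₃ ∧
        s ≠ (s⁻¹ʳ + (TropicalVariety.cst S a₁)⁻¹ʳ)⁻¹ʳ ∧
        (s + TropicalVariety.cst S a₁) * (s⁻¹ʳ + (TropicalVariety.cst S a₂)⁻¹ʳ)⁻¹ʳ =
          (TropicalVariety.cst S a₁ * (TropicalVariety.cst S a₂)⁻¹ʳ) *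
            (s + TropicalVariety.cst S a₂) *
              (s⁻¹ʳ + (TropicalVariety.cst S a₃)⁻¹ʳ)⁻¹ʳ := by
  open TropicalVariety in
  constructor
  · rintro ⟨hne, hV⟩
    obtain ⟨f, φ, hf, ε, hε, hor, ⟨x, hx, hx0⟩, y, hy, hyε⟩ :=
      exists_represents_of_not_isPreconnected hfg fun h => hV ⟨hne, h⟩
    -- The three quarter points of `(0, ε)` lie strictly inside the gap, as the strict inequalities
    -- at `x` and `y` require.
    have h₃₂ : ε / 4 < ε / 2 := by linarith
    have h₂₁ : ε / 2 < 3 * ε / 4 := by linarith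
    have h : 3 * ε / 4 - ε / 2 = ε / 2 - ε / 4 := by ring
    refine ⟨ψ f, 3 * ε / 4, ε / 2, ε / 4, ?_, h₃₂, h₂₁, h,
      (separation_conditions_iff hE hf h₃₂ h₂₁ h).mpr ⟨⟨x, hx, by linarith⟩, ⟨y, hy, by linarith⟩,
        fun z hz => (hor z hz).imp (fun h => by linarith) fun h => by linarith⟩⟩
    rw [ne_eq, map_eq_zero_iff_of_represents hE hf]
    exact hne.ne_empty
  · rintro ⟨s, a₁, a₂, a₃, hs, h₃₂, h₂₁, h, hcond⟩
    obtain ⟨f, rfl⟩ := hψ s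
    obtain ⟨φ, hf⟩ := exists_represents fun h0 : f = 0 => hs (by rw [h0, map_zero])
    obtain ⟨⟨x, hx, hx₃⟩, ⟨y, hy, hy₁⟩, hor⟩ :=
      (separation_conditions_iff hE hf h₃₂ h₂₁ h).mp hcond
    refine ⟨⟨x, hx⟩, fun hV => ?_⟩
    -- On a connected `V` the function `φ` would take the forbidden value `a₂`.
    obtain ⟨z, hz, hza⟩ := hV.isPreconnected.intermediate_value hx hy hf.continuous.continuousOn
      ⟨(hx₃.trans h₃₂).le, (h₂₁.trans hy₁).le⟩
    rcases hor z hz with h | h <;> linarith
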